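/- Let $0<q<1$ and let $\nu>-1$ be real with $\nu\notin\{0,1,2,\dots\}$. Write $(a;p)_n=\prod_{i=0}^{n-1}(1-ap^i)$, $(a;p)_\infty=\prod_{i\ge0}(1-ap^i)$, $\mathbb{R}_q^+=\{q^n : n\in\mathbb{Z}\}$, $\int_0^\infty f(t)\,d_qt=(1-q)\sum_{n\in\mathbb{Z}}q^nf(q^n)$, and, for $x\in\mathbb{C}$, $$j_\nu(x,q^2)=\sum_{n\ge0}(-1)^n\frac{q^{n(n+1)}}{(q^2;q^2)_n(q^{2\nu+2};q^2)_n}x^{2n},\qquad c_{q,\nu}=\frac1{1-q}\frac{(q^{2\nu+2};q^2)_\infty}{(q^2;q^2)_\infty}.$$ For $x\in\mathbb{R}_q^+$ define the modified $q$-Bessel functions $I_\nu(x,q^2)=j_\nu(ix,q^2)$ and $\pi_\nu(x,q^2)=x^{-2\nu}j_{-\nu}(q^{-\nu}ix,q^2)$, and the $q$-Macdonald function $$K_\nu(x,q^2)=c_{q,\nu}\int_0^\infty(1+t^2)^{-1}j_\nu(tx,q^2)\,t^{2\nu+1}\,d_qt .$$ Then for every $x\in\mathbb{R}_q^+$ the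 series defining $K_\nu(x,q^2)$ converges absolutely and $$K_\nu(x,q^2)=\alpha_\nu\bigl[\pi_\nu(x,q^2)-\beta_\nu I_\nu(x,q^2)\bigr],$$ where $$\beta_\nu=\frac{(q^{2\nu+2};q^2)_\infty}{(q^{-2\nu+2};q^2)_\infty}\,\frac{(-q^{2\nu};q^2)_\infty(-q^{2-2\nu};q^2)_\infty}{(-1;q^2)_\infty(-q^2;q^2)_\infty}$$ and $$\alpha_\nu=\frac{(q^2;q^2)_\infty}{(q^{2\nu};q^2)_\infty}\ \text{ if }\nu\ge0,\qquad \alpha_\nu=-\frac{c_{q,\nu}}{\beta_\nu}\int_0^\infty(1+t^2)^{-1}t^{2\nu+1}\,d_qt\ \text{ if }\nu<0,$$ the last $q$-integral being absolutely convergent when $\nu<0$. -/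

import Mathlib

open Filter Topology

noncomputable section

/-- The finite `q`-shifted factorial `(a;q)_n = ∏_{i<n} (1 - a q^i)`. -/
def qPoch (a q : ℝ) (n : ℕ) : ℝ := ∏ i ∈ Finset.range n, (1 - a * q ^ i)

/-- The infinite `q`-shifted factorial `(a;q)_∞ = ∏_{i≥0} (1 - a q^i)`. -/
def qPochInf (a q : ℝ) : ℝ := ∏' i : ℕ, (1 - a * q ^ i)

/-- The infinite product in `qPochInf` converges for `0 < q < 1`. -/
theorem multipliable_qPochInf (a q : ℝ) (hq0 : 0 < q) (hq1 : q < 1) :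
    Multipliable (fun i : ℕ => 1 - a * q ^ i) := by
  have h : Summable (fun i : ℕ => ‖-(a * q ^ i)‖) := by
    have h1 : Summable (fun i : ℕ => |a| * q ^ i) :=
      (summable_geometric_of_lt_one hq0.le hq1).mul_left _
    refine h1.congr fun i => ?_
    rw [norm_neg, Real.norm_eq_abs, abs_mul, abs_of_pos (pow_pos hq0 i)]
  simpa [sub_eq_add_neg] using multipliable_one_add_of_summable h

/-- The lattice `ℝ_q^+ = {q^n : n ∈ ℤ}`. -/
def qLattice (q : ℝ) : Set ℝ := {x | ∃ n : ℤ, x = q ^ n}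

/-- Convergence of the bilateral series that defines the Jackson `q`-integral over `(0,∞)`. -/
def QIntegrable {E : Type*} [NormedAddCommGroup E] [NormedSpace ℝ E] (q : ℝ) (f : ℝ → E) : Prop :=
  Summable fun n : ℤ => q ^ n • f (q ^ n)

/-- Jackson's `q`-integral `∫_0^∞ f(x) d_q x = (1-q) ∑_{n∈ℤ} q^n f(q^n)`. -/
def qIntegral {E : Type*} [NormedAddCommGroup E] [NormedSpace ℝ E] (q : ℝ) (f : ℝ → E) : E :=
  (1 - q) • ∑' n : ℤ, q ^ n • f (q ^ n)

/-- The general term of the series of the normalized third Jackson `q`-Bessel function. -/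
def qBesselTerm (ν : ℝ) (x : ℂ) (q : ℝ) (n : ℕ) : ℂ :=
  (-1) ^ n * ((q ^ (n * (n + 1) / 2) / (qPoch q q n * qPoch (q ^ (ν + 1)) q n) : ℝ) : ℂ)
    * x ^ (2 * n)

/-- The normalized third Jackson (Hahn-Exton) `q`-Bessel function
`j_ν(x;q) = ∑_{n≥0} (-1)^n q^{n(n+1)/2} / ((q;q)_n (q^{ν+1};q)_n) x^{2n}`. -/
def qBesselJ (ν : ℝ) (x : ℂ) (q : ℝ) : ℂ := ∑' n : ℕ, qBesselTerm ν x q n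

/-- The series in `qBesselJ` converges for every complex `x` when `0 < q < 1`. -/
theorem summable_qBesselTerm (ν : ℝ) (x : ℂ) (q : ℝ) (hq0 : 0 < q) (hq1 : q < 1) :
    Summable (qBesselTerm ν x q) := by
  have hrec : ∀ n, qBesselTerm ν x q (n + 1) = qBesselTerm ν x q n *
      (-((q ^ (n + 1) / ((1 - q * q ^ n) * (1 - q ^ (ν + 1) * q ^ n)) : ℝ) : ℂ) * x ^ 2) := by
    intro n
    have hexp : (n + 1) * (n + 1 + 1) / 2 = n * (n + 1) / 2 + (n + 1) := by
      rw [show (n + 1) * (n + 1 + 1) = n * (n + 1) + (n + 1) * 2 by ring]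
      exact Nat.add_mul_div_right _ _ (by norm_num)
    simp only [qBesselTerm, qPoch, Finset.prod_range_succ, hexp, pow_add, pow_one]
    push_cast
    simp only [div_eq_mul_inv, mul_inv]
    ring
  have hp : Tendsto (fun n : ℕ => q ^ n) atTop (𝓝 0) :=
    tendsto_pow_atTop_nhds_zero_of_lt_one hq0.le hq1
  have hreal : Tendsto
      (fun n : ℕ => q ^ (n + 1) / ((1 - q * q ^ n) * (1 - q ^ (ν + 1) * q ^ n))) atTop (𝓝 0) := by
    have h := ((tendsto_add_atTop_iff_nat 1).2 hp).div
      (((hp.const_mul q).const_sub 1).mul ((hp.const_mul (q ^ (ν + 1))).const_sub 1)) (by simp)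
    simpa [Pi.div_def] using h
  have hlim : Tendsto (fun n : ℕ =>
      ‖-((q ^ (n + 1) / ((1 - q * q ^ n) * (1 - q ^ (ν + 1) * q ^ n)) : ℝ) : ℂ) * x ^ 2‖)
      atTop (𝓝 0) := by
    have h := (((Complex.continuous_ofReal.tendsto 0).comp hreal).neg.mul_const (x ^ 2)).norm
    simpa [Function.comp_def] using h
  refine summable_of_ratio_norm_eventually_le (r := 1 / 2) (by norm_num) ?_
  filter_upwards [hlim.eventually (ge_mem_nhds (show (0 : ℝ) < 1 / 2 by norm_num))] with n hn
  rw [hrec, norm_mul, mul_comm]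
  exact mul_le_mul_of_nonneg_right hn (norm_nonneg _)

/-- The modified `q`-Bessel function `I_ν(x,q²) = j_ν(ix,q²)`. -/
def qBesselI (ν q x : ℝ) : ℂ := qBesselJ ν (Complex.I * x) (q ^ 2)

/-- The modified `q`-Bessel function `π_ν(x,q²) = x^{-2ν} j_{-ν}(q^{-ν} i x,q²)`, for `x > 0`. -/
def qBesselPi (ν q x : ℝ) : ℂ :=
  ((x ^ (-2 * ν) : ℝ) : ℂ) * qBesselJ (-ν) (((q ^ (-ν) : ℝ) : ℂ) * Complex.I * x) (q ^ 2)

/-- `c_{q,ν} = (q^{2ν+2};q²)_∞ / ((1-q) (q²;q²)_∞)`. -/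
def qBesselC (ν q : ℝ) : ℝ :=
  1 / (1 - q) * (qPochInf (q ^ (2 * ν + 2)) (q ^ 2) / qPochInf (q ^ 2) (q ^ 2))

/-- The integrand `t ↦ (1+t²)^{-1} j_ν(tx,q²) t^{2ν+1}` of the `q`-Macdonald function. -/
def qMacdonaldIntegrand (ν q x t : ℝ) : ℂ :=
  (((1 + t ^ 2)⁻¹ : ℝ) : ℂ) * qBesselJ ν ((t : ℂ) * x) (q ^ 2) * ((t ^ (2 * ν + 1) : ℝ) : ℂ)

/-- The `q`-Macdonald function
`K_ν(x,q²) = c_{q,ν} ∫_0^∞ (1+t²)^{-1} j_ν(tx,q²) t^{2ν+1} d_q t`. -/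
def qMacdonald (ν q x : ℝ) : ℂ :=
  (qBesselC ν q : ℂ) * qIntegral q (qMacdonaldIntegrand ν q x)

/-- The constant `β_ν`. -/
def qMacdonaldBeta (ν q : ℝ) : ℝ :=
  qPochInf (q ^ (2 * ν + 2)) (q ^ 2) / qPochInf (q ^ (-2 * ν + 2)) (q ^ 2) *
    (qPochInf (-q ^ (2 * ν)) (q ^ 2) * qPochInf (-q ^ (2 - 2 * ν)) (q ^ 2) /
      (qPochInf (-1) (q ^ 2) * qPochInf (-q ^ 2) (q ^ 2)))

/-- The constant `α_ν`. -/
def qMacdonaldAlpha (ν q : ℝ) : ℝ :=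
  if 0 ≤ ν then qPochInf (q ^ 2) (q ^ 2) / qPochInf (q ^ (2 * ν)) (q ^ 2)
  else -(qBesselC ν q / qMacdonaldBeta ν q) *
    qIntegral q (fun t : ℝ => (1 + t ^ 2)⁻¹ * t ^ (2 * ν + 1))

end

/-! ### Power series and the shifted factorials -/

/-! Put `p = q²`, `b = p^ν`, `w = bp` and `x = q^k`. As functions of `k`, the three objects `I_ν`,
`π_ν` and `K_ν` solve one second-order linear difference equation, `ModifiedBesselEq p b`. For `I_ν`
and `π_ν` this is the recurrence `hahnExton_recurrence` of the Hahn-Exton series. For `K_ν` the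
recurrence under the sum produces a factor `1 + p^n` that cancels the weight, and what remains is a
Mellin sum that vanishes (`hasSum_zpow_mul_hahnExton_self`).

As `k → -∞`, the solution `I_ν` is bounded below by 1, `K_ν` tends to 0, and `π_ν / I_ν` tends to
`β_ν`. Hence `K_ν` and `π_ν - β_ν I_ν` are both negligible against `I_ν`. A Casoratian argument
shows that such solutions form a line (`ModifiedBesselEq.exists_eq_mul`), so the two are
proportional.

The factor `α_ν` is read off as `k → +∞`, where `I_ν → 1` and `π_ν` behaves like `b^(-k)`. If `b <
1`, then `π_ν` dominates and the limit of `b^k K_ν` is a Mellin sum in closed form; if `b > 1`, then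
`π_ν → 0` and `K_ν` itself has a limit. This is the origin of the two cases in `α_ν`. Two tools make
the limits explicit: Euler's expansions and the symmetry `hahnExton_comm`. -/

theorem tendsto_tsum_mul_pow {ι : Type*} {l : Filter ι} {c : ℕ → ℝ} (hc : Summable c)
    {z : ι → ℝ} (hz : Tendsto z l (𝓝 0)) :
    Tendsto (fun k => ∑' j, c j * z k ^ j) l (𝓝 (c 0)) := by
  have h0 : ∑' j, c j * (0 : ℝ) ^ j = c 0 := by
    rw [tsum_eq_single 0 (fun j hj => by simp [hj])]
    simp
  rw [← h0]
  refine tendsto_tsum_of_dominated_convergence hc.norm (fun j => (hz.pow j).const_mul _) ?_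
  have h1 : ∀ᶠ k in l, ‖z k‖ ≤ 1 := by
    have := hz.norm
    rw [norm_zero] at this
    exact this.eventually (ge_mem_nhds one_pos)
  filter_upwards [h1] with k hk j
  rw [norm_mul, norm_pow]
  exact mul_le_of_le_one_right (norm_nonneg _) (pow_le_one₀ (norm_nonneg _) hk)

theorem tendsto_qPoch {p : ℝ} (hp0 : 0 < p) (hp1 : p < 1) (a : ℝ) :
    Tendsto (qPoch a p) atTop (𝓝 (qPochInf a p)) :=
  (multipliable_qPochInf a p hp0 hp1).hasProd.tendsto_prod_nat

theorem qPoch_succ (a p : ℝ) (n : ℕ) : qPoch a p (n + 1) = qPoch a p n * (1 - a * p ^ n) :=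
  Finset.prod_range_succ _ _

theorem qPoch_succ' (a p : ℝ) (n : ℕ) : qPoch a p (n + 1) = (1 - a) * qPoch (a * p) p n := by
  simp only [qPoch, Finset.prod_range_succ', pow_zero, mul_one, pow_succ']
  rw [mul_comm]
  simp only [mul_assoc]

theorem qPoch_ne_zero {a p : ℝ} (h : ∀ i : ℕ, a * p ^ i ≠ 1) (n : ℕ) : qPoch a p n ≠ 0 :=
  Finset.prod_ne_zero_iff.2 fun i _ => sub_ne_zero.2 (h i).symm

theorem qPoch_pos {a p : ℝ} (hp0 : 0 < p) (hp1 : p < 1) (ha : a < 1) (n : ℕ) :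
    0 < qPoch a p n := by
  refine Finset.prod_pos fun i _ => sub_pos.2 ?_
  rcases le_or_gt a 0 with h | h
  · exact (mul_nonpos_of_nonpos_of_nonneg h (pow_pos hp0 i).le).trans_lt one_pos
  · exact (mul_le_of_le_one_right h.le (pow_le_one₀ hp0.le hp1.le)).trans_lt ha

theorem qPochInf_eq_mul {p : ℝ} (hp0 : 0 < p) (hp1 : p < 1) (a : ℝ) :
    qPochInf a p = (1 - a) * qPochInf (a * p) p := by
  have h1 := (tendsto_add_atTop_iff_nat 1).2 (tendsto_qPoch hp0 hp1 a)
  simp only [qPoch_succ'] at h1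
  exact tendsto_nhds_unique h1 ((tendsto_qPoch hp0 hp1 (a * p)).const_mul _)

theorem qPochInf_eq_qPoch_mul {p : ℝ} (hp0 : 0 < p) (hp1 : p < 1) (a : ℝ) (n : ℕ) :
    qPochInf a p = qPoch a p n * qPochInf (a * p ^ n) p := by
  induction n with
  | zero => simp [qPoch]
  | succ n ih =>
    rw [ih, qPochInf_eq_mul hp0 hp1 (a * p ^ n), qPoch_succ, pow_succ]
    ring_nf

/-- The factor of index `-m` is `1 - p^m p^(-m) = 0`. This makes bilateral sums over the lattice
one-sided. -/
theorem qPochInf_zpow_of_nonpos {p : ℝ} (hp0 : 0 < p) (hp1 : p < 1) {m : ℤ} (hm : m ≤ 0) :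
    qPochInf (p ^ m) p = 0 := by
  obtain ⟨n, rfl⟩ : ∃ n : ℕ, m = -n := ⟨m.natAbs, by omega⟩
  rw [qPochInf_eq_qPoch_mul hp0 hp1 _ (n + 1), qPoch_succ]
  simp [hp0.ne']

/-! ### Euler's two expansions -/

/-- The coefficients of Euler's expansion of `(a;p)_∞` in powers of `a`. -/
noncomputable def eulerCoeff (p : ℝ) (j : ℕ) : ℝ := (-1) ^ j * p ^ (j.choose 2) / qPoch p p j

theorem eulerCoeff_zero (p : ℝ) : eulerCoeff p 0 = 1 := by simp [eulerCoeff, qPoch]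

theorem pow_succ_lt_one {p : ℝ} (hp0 : 0 < p) (hp1 : p < 1) (j : ℕ) : p ^ (j + 1) < 1 :=
  pow_lt_one₀ hp0.le hp1 (Nat.succ_ne_zero j)

theorem eulerCoeff_succ {p : ℝ} (hp0 : 0 < p) (hp1 : p < 1) (j : ℕ) :
    eulerCoeff p (j + 1) * (1 - p ^ (j + 1)) = -(p ^ j * eulerCoeff p j) := by
  have h1 := (qPoch_pos hp0 hp1 hp1 j).ne'
  have h2 : 1 - p ^ (j + 1) ≠ 0 := (sub_pos.2 (pow_succ_lt_one hp0 hp1 j)).ne'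
  have h3 : (j + 1).choose 2 = j + j.choose 2 := by simp [Nat.choose_succ_succ']
  rw [eulerCoeff, eulerCoeff, qPoch_succ, h3, ← pow_succ']
  field_simp
  ring

theorem summable_of_tendsto_ratio {c r : ℕ → ℝ} {l : ℝ} (hl : |l| < 1)
    (hr : Tendsto r atTop (𝓝 l)) (h : ∀ n, c (n + 1) = r n * c n) : Summable c := by
  obtain ⟨s, hs1, hs2⟩ := exists_between hl
  refine summable_of_ratio_norm_eventually_le hs2 ?_
  filter_upwards [hr.abs.eventually (ge_mem_nhds hs1)] with n hn
  rw [h, norm_mul]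
  exact mul_le_mul_of_nonneg_right hn (norm_nonneg _)

theorem summable_eulerCoeff {p : ℝ} (hp0 : 0 < p) (hp1 : p < 1) (a : ℝ) :
    Summable fun j => eulerCoeff p j * a ^ j := by
  have hp : Tendsto (fun n : ℕ => p ^ n) atTop (𝓝 0) :=
    tendsto_pow_atTop_nhds_zero_of_lt_one hp0.le hp1
  have hr : Tendsto (fun j : ℕ => -(p ^ j * a / (1 - p ^ (j + 1)))) atTop (𝓝 0) := by
    have h := ((hp.mul_const a).div (((tendsto_add_atTop_iff_nat 1).2 hp).const_sub 1)
      (by simp)).neg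
    simpa using h
  refine summable_of_tendsto_ratio (by simp) hr fun j => ?_
  have h2 : 1 - p ^ (j + 1) ≠ 0 := (sub_pos.2 (pow_succ_lt_one hp0 hp1 j)).ne'
  field_simp
  linear_combination a ^ (j + 1) * eulerCoeff_succ hp0 hp1 j

/-- The series satisfies `F(a) = (1 - a) F(ap)`, like the product. Iterating and letting `ap^n → 0`,
where `F` tends to 1, identifies the two. -/
theorem hasSum_eulerCoeff {p : ℝ} (hp0 : 0 < p) (hp1 : p < 1) (a : ℝ) :
    HasSum (fun j => eulerCoeff p j * a ^ j) (qPochInf a p) := by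
  have hs := summable_eulerCoeff hp0 hp1
  have hstep : ∀ a, ∑' j, eulerCoeff p j * a ^ j =
      (1 - a) * ∑' j, eulerCoeff p j * (a * p) ^ j := by
    intro a
    have h1 : ∑' j, eulerCoeff p j * a ^ j - ∑' j, eulerCoeff p j * (a * p) ^ j =
        -a * ∑' j, eulerCoeff p j * (a * p) ^ j := by
      rw [← (hs a).tsum_sub (hs (a * p)), ((hs a).sub (hs (a * p))).tsum_eq_zero_add, ← tsum_mul_left]
      simp only [pow_zero, sub_self, zero_add]
      refine tsum_congr fun j => ?_
      rw [mul_pow, mul_pow]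
      linear_combination a ^ (j + 1) * eulerCoeff_succ hp0 hp1 j
    linear_combination h1
  have hiter : ∀ n : ℕ, ∑' j, eulerCoeff p j * a ^ j =
      qPoch a p n * ∑' j, eulerCoeff p j * (a * p ^ n) ^ j := by
    intro n
    induction n with
    | zero => simp [qPoch]
    | succ n ih =>
      rw [ih, hstep (a * p ^ n), qPoch_succ, pow_succ]
      simp only [mul_assoc]
  have hlim : Tendsto (fun n : ℕ => a * p ^ n) atTop (𝓝 0) := by
    simpa using (tendsto_pow_atTop_nhds_zero_of_lt_one hp0.le hp1).const_mul a
  have h1 := tendsto_tsum_mul_pow (by simpa using hs 1) hlim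
  have h2 := (tendsto_qPoch hp0 hp1 a).mul h1
  simp only [← hiter, eulerCoeff_zero, mul_one] at h2
  rw [← tendsto_nhds_unique tendsto_const_nhds h2]
  exact (hs a).hasSum

theorem summable_pow_div_qPoch {p : ℝ} (hp0 : 0 < p) (hp1 : p < 1) {u : ℝ} (hu : |u| < 1) :
    Summable fun m => (qPoch p p m)⁻¹ * u ^ m := by
  have hp : Tendsto (fun n : ℕ => p ^ n) atTop (𝓝 0) :=
    tendsto_pow_atTop_nhds_zero_of_lt_one hp0.le hp1
  have hr : Tendsto (fun j : ℕ => u / (1 - p ^ (j + 1))) atTop (𝓝 u) := by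
    have h := (tendsto_const_nhds (x := u)).div
      (((tendsto_add_atTop_iff_nat 1).2 hp).const_sub 1) (by simp)
    simpa [Pi.div_def] using h
  refine summable_of_tendsto_ratio hu hr fun j => ?_
  have h2 : 1 - p ^ (j + 1) ≠ 0 := (sub_pos.2 (pow_succ_lt_one hp0 hp1 j)).ne'
  have h1 := (qPoch_pos hp0 hp1 hp1 j).ne'
  rw [qPoch_succ, ← pow_succ']
  field_simp
  ring

/-- Euler's second expansion, from `(1 - u) G(u) = G(up)`. In this form it also shows that `(u;p)_∞`
does not vanish for `|u| < 1`. -/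
theorem qPochInf_mul_tsum {p : ℝ} (hp0 : 0 < p) (hp1 : p < 1) {u : ℝ} (hu : |u| < 1) :
    qPochInf u p * ∑' m, (qPoch p p m)⁻¹ * u ^ m = 1 := by
  have habs : ∀ {a : ℝ} (n : ℕ), |a| < 1 → |a * p ^ n| < 1 := fun n h => by
    rw [abs_mul, abs_of_pos (pow_pos hp0 n)]
    exact (mul_le_of_le_one_right (abs_nonneg _) (pow_le_one₀ hp0.le hp1.le)).trans_lt h
  have hs := fun {a : ℝ} (h : |a| < 1) => summable_pow_div_qPoch hp0 hp1 h
  have hstep : ∀ a : ℝ, |a| < 1 → (1 - a) * ∑' m, (qPoch p p m)⁻¹ * a ^ m =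
      ∑' m, (qPoch p p m)⁻¹ * (a * p) ^ m := by
    intro a ha
    have ha' : |a * p| < 1 := by simpa using habs 1 ha
    have h1 : ∑' m, (qPoch p p m)⁻¹ * a ^ m - ∑' m, (qPoch p p m)⁻¹ * (a * p) ^ m =
        a * ∑' m, (qPoch p p m)⁻¹ * a ^ m := by
      rw [← (hs ha).tsum_sub (hs ha'), ((hs ha).sub (hs ha')).tsum_eq_zero_add, ← tsum_mul_left]
      simp only [pow_zero, sub_self, zero_add]
      refine tsum_congr fun j => ?_
      have h2 : 1 - p ^ (j + 1) ≠ 0 := (sub_pos.2 (pow_succ_lt_one hp0 hp1 j)).ne'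
      have h1 := (qPoch_pos hp0 hp1 hp1 j).ne'
      rw [qPoch_succ, ← pow_succ']
      field_simp
      ring
    linear_combination h1
  have hiter : ∀ n : ℕ, qPoch u p n * ∑' m, (qPoch p p m)⁻¹ * u ^ m =
      ∑' m, (qPoch p p m)⁻¹ * (u * p ^ n) ^ m := by
    intro n
    induction n with
    | zero => simp [qPoch]
    | succ n ih =>
      rw [qPoch_succ, mul_right_comm, ih, mul_comm, hstep _ (habs n hu), pow_succ]
      simp only [mul_assoc]
  -- The coefficients `1/(p;p)_m` are not summable, so a factor `p^m` is moved into them and the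
  -- argument is divided by `p`.
  have hlim : Tendsto (fun n : ℕ => u * p ^ n / p) atTop (𝓝 0) := by
    simpa using ((tendsto_pow_atTop_nhds_zero_of_lt_one hp0.le hp1).const_mul u).div_const p
  have h1 := tendsto_tsum_mul_pow (hs (show |p| < 1 by rwa [abs_of_pos hp0])) hlim
  have h2 := (tendsto_qPoch hp0 hp1 u).mul_const (∑' m, (qPoch p p m)⁻¹ * u ^ m)
  have h3 : ∀ (n m : ℕ), (qPoch p p m)⁻¹ * p ^ m * (u * p ^ n / p) ^ m =
      (qPoch p p m)⁻¹ * (u * p ^ n) ^ m := by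
    intro n m
    rw [mul_assoc, ← mul_pow]
    congr 2
    field_simp
  simp only [h3, ← hiter] at h1
  simpa [qPoch] using tendsto_nhds_unique h2 h1

theorem qPochInf_ne_zero {a p : ℝ} (hp0 : 0 < p) (hp1 : p < 1) (h : ∀ i : ℕ, a * p ^ i ≠ 1) :
    qPochInf a p ≠ 0 := by
  have hlim : Tendsto (fun n : ℕ => |a * p ^ n|) atTop (𝓝 0) := by
    simpa using ((tendsto_pow_atTop_nhds_zero_of_lt_one hp0.le hp1).const_mul a).abs
  obtain ⟨n, hn⟩ := (hlim.eventually (gt_mem_nhds one_pos)).exists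
  rw [qPochInf_eq_qPoch_mul hp0 hp1 a n]
  exact mul_ne_zero (qPoch_ne_zero h n) (left_ne_zero_of_mul_eq_one (qPochInf_mul_tsum hp0 hp1 hn))

theorem qPochInf_ne_zero_of_lt_one {a p : ℝ} (hp0 : 0 < p) (hp1 : p < 1) (ha : a < 1) :
    qPochInf a p ≠ 0 := by
  refine qPochInf_ne_zero hp0 hp1 fun i => ne_of_lt ?_
  rcases le_or_gt a 0 with h | h
  · exact (mul_nonpos_of_nonpos_of_nonneg h (pow_pos hp0 i).le).trans_lt one_pos
  · exact (mul_le_of_le_one_right h.le (pow_le_one₀ hp0.le hp1.le)).trans_lt ha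

theorem exists_abs_qPochInf_le {p : ℝ} (hp0 : 0 < p) (hp1 : p < 1) (w : ℝ) :
    ∃ C, ∀ k : ℕ, |qPochInf (w * p ^ k) p| ≤ C := by
  refine ⟨∑' j, ‖eulerCoeff p j * w ^ j‖, fun k => ?_⟩
  rw [← (hasSum_eulerCoeff hp0 hp1 _).tsum_eq, ← Real.norm_eq_abs]
  refine tsum_of_norm_bounded (summable_eulerCoeff hp0 hp1 w).norm.hasSum fun j => ?_
  rw [norm_mul, norm_mul, mul_pow, norm_mul, ← pow_mul, norm_pow p, Real.norm_of_nonneg hp0.le]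
  gcongr
  exact mul_le_of_le_one_right (norm_nonneg _) (pow_le_one₀ hp0.le hp1.le)

/-! ### The Hahn-Exton function -/

/-- The Hahn-Exton series `(w;p)_∞ ₁φ₁(0;w;p,z) = ∑_k (-1)^k p^{k(k-1)/2} (w p^k;p)_∞ z^k / (p;p)_k`. -/
noncomputable def hahnExton (p w z : ℝ) : ℝ :=
  ∑' k, eulerCoeff p k * qPochInf (w * p ^ k) p * z ^ k

theorem summable_hahnExton {p : ℝ} (hp0 : 0 < p) (hp1 : p < 1) (w z : ℝ) :
    Summable fun k => eulerCoeff p k * qPochInf (w * p ^ k) p * z ^ k := by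
  obtain ⟨C, hC⟩ := exists_abs_qPochInf_le hp0 hp1 w
  refine Summable.of_norm_bounded ((summable_eulerCoeff hp0 hp1 z).norm.mul_left C) fun k => ?_
  rw [mul_right_comm, norm_mul, mul_comm]
  exact mul_le_mul_of_nonneg_right (hC k) (norm_nonneg _)

theorem summable_hahnExton_double {p : ℝ} (hp0 : 0 < p) (hp1 : p < 1) (w z : ℝ) :
    Summable fun x : ℕ × ℕ =>
      eulerCoeff p x.1 * z ^ x.1 * (eulerCoeff p x.2 * (w * p ^ x.1) ^ x.2) := by
  have h := (summable_eulerCoeff hp0 hp1 z).norm.mul_of_nonneg (summable_eulerCoeff hp0 hp1 w).norm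
    (fun _ => norm_nonneg _) (fun _ => norm_nonneg _)
  refine Summable.of_norm_bounded h fun x => ?_
  rw [norm_mul]
  refine mul_le_mul_of_nonneg_left ?_ (norm_nonneg _)
  rw [norm_mul, norm_mul, mul_pow, norm_mul, ← pow_mul, norm_pow p, Real.norm_of_nonneg hp0.le]
  gcongr
  exact mul_le_of_le_one_right (norm_nonneg _) (pow_le_one₀ hp0.le hp1.le)

theorem hahnExton_eq_tsum_tsum {p : ℝ} (hp0 : 0 < p) (hp1 : p < 1) (w z : ℝ) :
    hahnExton p w z =
      ∑' k, ∑' j, eulerCoeff p k * z ^ k * (eulerCoeff p j * (w * p ^ k) ^ j) := by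
  refine tsum_congr fun k => ?_
  rw [tsum_mul_left, (hasSum_eulerCoeff hp0 hp1 _).tsum_eq]
  ring

/-- Expanding `(w p^k;p)_∞` by Euler gives an absolutely convergent double series whose only
coupling is `p^(kj)`, symmetric in the two indices. -/
theorem hahnExton_comm {p : ℝ} (hp0 : 0 < p) (hp1 : p < 1) (w z : ℝ) :
    hahnExton p w z = hahnExton p z w := by
  rw [hahnExton_eq_tsum_tsum hp0 hp1, hahnExton_eq_tsum_tsum hp0 hp1]
  refine (Summable.tsum_comm (f := fun k j : ℕ => eulerCoeff p k * z ^ k *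
    (eulerCoeff p j * (w * p ^ k) ^ j)) (summable_hahnExton_double hp0 hp1 w z)).symm.trans ?_
  refine tsum_congr fun j => tsum_congr fun k => ?_
  rw [mul_pow, mul_pow, ← pow_mul, ← pow_mul]
  ring

/-- On `z^k` the left side acts as multiplication by `(1 - p^k)(1 - w p^(k-1))`. It kills the
constant term and lowers the other coefficients to their predecessors. -/
theorem hahnExton_recurrence {p : ℝ} (hp0 : 0 < p) (hp1 : p < 1) (w z : ℝ) :
    hahnExton p w z - (1 + w / p) * hahnExton p w (p * z) + w / p * hahnExton p w (p * (p * z)) =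
      -z * hahnExton p w (p * z) := by
  have hs := summable_hahnExton hp0 hp1 w
  unfold hahnExton
  have h := (((hs z).sub ((hs (p * z)).mul_left (1 + w / p))).add
    ((hs (p * (p * z))).mul_left (w / p)))
  rw [← tsum_mul_left, ← tsum_mul_left, ← tsum_mul_left,
    ← (hs z).tsum_sub ((hs (p * z)).mul_left (1 + w / p)),
    ← ((hs z).sub ((hs (p * z)).mul_left (1 + w / p))).tsum_add
      ((hs (p * (p * z))).mul_left (w / p)), h.tsum_eq_zero_add]
  have h0 : ∀ c : ℝ, c - (1 + w / p) * c + w / p * c = 0 := fun c => by ring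
  simp only [pow_zero, h0, zero_add]
  refine tsum_congr fun k => ?_
  have h1 := eulerCoeff_succ hp0 hp1 k
  have h2 := qPochInf_eq_mul hp0 hp1 (w * p ^ k)
  rw [mul_assoc w, ← pow_succ] at h2
  rw [h2]
  have h3 : w / p * p ^ (k + 1) = w * p ^ k := by rw [pow_succ]; field_simp
  simp only [mul_pow]
  linear_combination z ^ (k + 1) * qPochInf (w * p ^ (k + 1)) p * ((1 - w * p ^ k) * h1 +
    eulerCoeff p (k + 1) * (p ^ (k + 1) - 1) * h3)

theorem tendsto_hahnExton_zero {ι : Type*} {l : Filter ι} {p : ℝ} (hp0 : 0 < p) (hp1 : p < 1)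
    (w : ℝ) {z : ι → ℝ} (hz : Tendsto z l (𝓝 0)) :
    Tendsto (fun k => hahnExton p w (z k)) l (𝓝 (qPochInf w p)) := by
  have h := tendsto_tsum_mul_pow (by simpa using summable_hahnExton hp0 hp1 w 1) hz
  simpa [eulerCoeff_zero, hahnExton] using h

/-! ### The Mellin transform on the lattice -/

theorem hasSum_zpow_mul_qPochInf {p u : ℝ} (hp0 : 0 < p) (hp1 : p < 1) (hu0 : 0 < u) (hu1 : u < 1) :
    HasSum (fun n : ℤ => u ^ n * qPochInf (p ^ n) p) (u * qPochInf p p / qPochInf u p) := by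
  have hinj : Function.Injective fun m : ℕ => (m : ℤ) + 1 := fun a b h => by
    simpa using h
  rw [← hinj.hasSum_iff]
  · have hu : |u| < 1 := by rwa [abs_of_pos hu0]
    have h1 := eq_inv_of_mul_eq_one_right (qPochInf_mul_tsum hp0 hp1 hu)
    have h := (summable_pow_div_qPoch hp0 hp1 hu).hasSum.mul_left (u * qPochInf p p)
    rw [h1, ← div_eq_mul_inv] at h
    refine h.congr_fun fun m => ?_
    have h2 := (qPoch_pos hp0 hp1 hp1 m).ne'
    have h3 := qPochInf_eq_qPoch_mul hp0 hp1 p m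
    simp only [Function.comp_apply]
    rw [h3, zpow_add₀ hu0.ne', zpow_add₀ hp0.ne', zpow_natCast, zpow_natCast, zpow_one, zpow_one,
      mul_comm (p ^ m) p]
    field_simp
  · intro n hn
    rw [qPochInf_zpow_of_nonpos hp0 hp1, mul_zero]
    by_contra! h
    exact hn ⟨(n - 1).toNat, by simp; omega⟩

/-- After the symmetry, the summand is a series in `(p^(m+j);p)_∞ w^j`. The shear `(m,j) ↦ (m+j,j)`
separates the double sum into a product of two Euler sums. -/
theorem hasSum_zpow_mul_hahnExton {p u : ℝ} (hp0 : 0 < p) (hp1 : p < 1) (hu0 : 0 < u) (hu1 : u < 1)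
    (w : ℝ) :
    HasSum (fun m : ℤ => u ^ m * hahnExton p w (p ^ m))
      (u * qPochInf p p / qPochInf u p * qPochInf (w / u) p) := by
  have hA := hasSum_zpow_mul_qPochInf hp0 hp1 hu0 hu1
  have hB := hasSum_eulerCoeff hp0 hp1 (w / u)
  have hs := summable_mul_of_summable_norm hA.summable.norm hB.summable.norm
  have hAB := HasSum.mul hA hB hs
  let σ : ℤ × ℕ ≃ ℤ × ℕ :=
    { toFun := fun x => (x.1 + x.2, x.2)
      invFun := fun x => (x.1 - x.2, x.2)
      left_inv := fun x => by simp
      right_inv := fun x => by simp }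
  have hσ : HasSum (fun x : ℤ × ℕ => u ^ (x.1 + x.2) * qPochInf (p ^ (x.1 + x.2)) p *
      (eulerCoeff p x.2 * (w / u) ^ x.2)) _ := σ.hasSum_iff.2 hAB
  have h (m : ℤ) : HasSum (fun j : ℕ => u ^ (m + j) * qPochInf (p ^ (m + j)) p *
      (eulerCoeff p j * (w / u) ^ j)) (u ^ m * hahnExton p w (p ^ m)) := by
    rw [hahnExton_comm hp0 hp1]
    have h := (summable_hahnExton hp0 hp1 (p ^ m) w).hasSum.mul_left (u ^ m)
    have e (j : ℕ) : u ^ (m + j) * qPochInf (p ^ (m + j)) p * (eulerCoeff p j * (w / u) ^ j) =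
        u ^ m * (eulerCoeff p j * qPochInf (p ^ m * p ^ j) p * w ^ j) := by
      rw [zpow_add₀ hu0.ne', zpow_add₀ hp0.ne', zpow_natCast, zpow_natCast, div_pow]
      field_simp
    simp only [e]
    exact h
  exact hσ.prod_fiberwise h

/-- At `u = w` the Mellin transform contains the factor `(1;p)_∞ = 0`; a shift by `k` only rescales
the sum. -/
theorem hasSum_zpow_mul_hahnExton_self {p w : ℝ} (hp0 : 0 < p) (hp1 : p < 1) (hw0 : 0 < w)
    (hw1 : w < 1) (k : ℤ) : HasSum (fun n : ℤ => w ^ n * hahnExton p w (p ^ (n + k))) 0 := by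
  have h := hasSum_zpow_mul_hahnExton hp0 hp1 hw0 hw1 w
  have h0 : qPochInf 1 p = 0 := by simpa using qPochInf_zpow_of_nonpos hp0 hp1 (le_refl 0)
  rw [div_self hw0.ne', h0, mul_zero] at h
  have h2 := ((Equiv.addRight k).hasSum_iff.2 h).mul_left (w ^ (-k))
  rw [mul_zero] at h2
  refine h2.congr_fun fun n => ?_
  simp only [Function.comp_apply, Equiv.coe_addRight]
  rw [← mul_assoc, ← zpow_add₀ hw0.ne']
  congr 2
  ring

/-- For `m ≥ 0` the power series at 1 dominates; for `m ≤ 0` the absolutely convergent Mellin sum at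
`u = p` bounds each of its terms. -/
theorem exists_abs_hahnExton_zpow_le {p w : ℝ} (hp0 : 0 < p) (hp1 : p < 1) :
    ∃ C, ∀ m : ℤ, |hahnExton p w (p ^ m)| ≤ C := by
  have h := (hasSum_zpow_mul_hahnExton hp0 hp1 hp0 hp1 w).summable.norm
  have h2 := (summable_hahnExton hp0 hp1 w 1).norm
  refine ⟨max (∑' m : ℤ, ‖p ^ m * hahnExton p w (p ^ m)‖)
    (∑' k, ‖eulerCoeff p k * qPochInf (w * p ^ k) p * 1 ^ k‖), fun m => ?_⟩
  rcases le_total m 0 with hm | hm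
  · refine le_max_of_le_left (le_trans ?_ (h.le_tsum m fun _ _ => norm_nonneg _))
    rw [norm_mul, Real.norm_of_nonneg (zpow_pos hp0 m).le, Real.norm_eq_abs]
    exact le_mul_of_one_le_left (abs_nonneg _) (one_le_zpow_of_nonpos₀ hp0 hp1.le hm)
  · refine le_max_of_le_right ?_
    rw [← Real.norm_eq_abs, hahnExton]
    refine tsum_of_norm_bounded h2.hasSum fun k => ?_
    rw [one_pow, mul_one, norm_mul, norm_pow, Real.norm_of_nonneg (zpow_pos hp0 m).le]
    exact mul_le_of_le_one_right (norm_nonneg _)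
      (pow_le_one₀ (zpow_pos hp0 m).le (zpow_le_one₀ hp0 hp1.le hm))

/-! ### The Casoratian of two solutions -/

/-- The difference equation `x(k) - (1+b) x(k+1) + b x(k+2) = p^{k+1} x(k+1)`. -/
def ModifiedBesselEq (p b : ℝ) (x : ℤ → ℝ) : Prop :=
  ∀ k : ℤ, x k - (1 + b) * x (k + 1) + b * x (k + 2) = p ^ (k + 1) * x (k + 1)

/-- The Casoratian (discrete Wronskian) of two sequences. -/
def casoratian (x y : ℤ → ℝ) (k : ℤ) : ℝ := x k * y (k + 1) - x (k + 1) * y k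

theorem ModifiedBesselEq.sub_mul {p b : ℝ} {x y : ℤ → ℝ} (hx : ModifiedBesselEq p b x)
    (hy : ModifiedBesselEq p b y) (c d : ℝ) : ModifiedBesselEq p b fun k => c * x k - d * y k :=
  fun k => by linear_combination c * hx k - d * hy k

theorem ModifiedBesselEq.casoratian_eq {p b : ℝ} {x y : ℤ → ℝ} (hx : ModifiedBesselEq p b x)
    (hy : ModifiedBesselEq p b y) (k : ℤ) : casoratian x y k = b * casoratian x y (k + 1) := by
  have e : k + 1 + 1 = k + 2 := by ring
  simp only [casoratian, e]
  linear_combination y (k + 1) * hx k - x (k + 1) * hy k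

theorem ModifiedBesselEq.casoratian_eq_zero {p b : ℝ} (hb : b ≠ 0) {x y : ℤ → ℝ}
    (hx : ModifiedBesselEq p b x) (hy : ModifiedBesselEq p b y) (h : casoratian x y 0 = 0) (k : ℤ) :
    casoratian x y k = 0 := by
  induction k with
  | zero => exact h
  | succ n ih =>
    rw [hx.casoratian_eq hy] at ih
    exact (mul_eq_zero.1 ih).resolve_left hb
  | pred n ih =>
    rw [hx.casoratian_eq hy, sub_add_cancel, ih, mul_zero]

theorem exists_eq_mul_of_casoratian_eq_zero {x y : ℤ → ℝ} (hy : ∀ k, y k ≠ 0)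
    (h : ∀ k, casoratian x y k = 0) : ∃ c, ∀ k, x k = c * y k := by
  have hstep : ∀ k, x (k + 1) / y (k + 1) = x k / y k := fun k => by
    rw [div_eq_div_iff (hy _) (hy _)]
    have := h k
    rw [casoratian] at this
    linarith
  refine ⟨x 0 / y 0, fun k => ?_⟩
  rw [← div_eq_iff (hy k)]
  induction k with
  | zero => rfl
  | succ n ih => rw [hstep, ih]
  | pred n ih => rw [← ih, ← hstep, sub_add_cancel]

/-- Uniqueness of the subdominant solution. With `W` the Casoratian, `W(g,y) f - W(f,y) g` has zero
Casoratian with `y`, hence is a multiple of `y`; dividing by `y` and letting `k → -∞` shows that the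
multiple is 0. -/
theorem ModifiedBesselEq.exists_eq_mul {p b : ℝ} (hb : b ≠ 0) {f g y : ℤ → ℝ}
    (hf : ModifiedBesselEq p b f) (hg : ModifiedBesselEq p b g) (hy : ModifiedBesselEq p b y)
    (hy0 : ∀ k, y k ≠ 0) (hfy : Tendsto (fun k => f k / y k) atBot (𝓝 0))
    (hgy : Tendsto (fun k => g k / y k) atBot (𝓝 0)) (h : casoratian g y 0 ≠ 0) :
    ∃ c, ∀ k, f k = c * g k := by
  refine ⟨casoratian f y 0 / casoratian g y 0, fun k => ?_⟩
  have hh := hf.sub_mul hg (casoratian g y 0) (casoratian f y 0)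
  obtain ⟨c, hc⟩ := exists_eq_mul_of_casoratian_eq_zero hy0
    (hh.casoratian_eq_zero hb hy (by simp only [casoratian]; ring))
  have hlim := (hfy.const_mul (casoratian g y 0)).sub (hgy.const_mul (casoratian f y 0))
  have hcst : ∀ k, casoratian g y 0 * (f k / y k) - casoratian f y 0 * (g k / y k) = c := by
    intro k
    rw [← mul_div_assoc, ← mul_div_assoc, ← sub_div, hc k, mul_div_cancel_right₀ _ (hy0 k)]
  simp only [hcst, mul_zero, sub_zero] at hlim
  have hc0 : c = 0 := tendsto_nhds_unique tendsto_const_nhds hlim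
  have := hc k
  rw [hc0, zero_mul, sub_eq_zero] at this
  rw [div_mul_eq_mul_div, eq_div_iff h, mul_comm, this]

/-! ### The three lattice functions -/

/-- The values of `I_ν` on the lattice. -/
noncomputable def besselISeq (p b : ℝ) (k : ℤ) : ℝ :=
  hahnExton p (b * p) (-p ^ (k + 1)) / qPochInf (b * p) p

/-- The values of `π_ν` on the lattice. -/
noncomputable def besselPiSeq (p b : ℝ) (k : ℤ) : ℝ :=
  (b ^ k)⁻¹ * (hahnExton p (p / b) (-(p ^ (k + 1) / b)) / qPochInf (p / b) p)

/-- The values of `(p;p)_∞ K_ν` on the lattice. -/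
noncomputable def macdonaldSeq (p w : ℝ) (k : ℤ) : ℝ :=
  ∑' n : ℤ, w ^ n / (1 + p ^ n) * hahnExton p w (p ^ (n + k + 1))

theorem summable_macdonaldSeq {p w : ℝ} (hp0 : 0 < p) (hp1 : p < 1) (hw0 : 0 < w) (hw1 : w < 1)
    (k : ℤ) : Summable fun n : ℤ => w ^ n / (1 + p ^ n) * hahnExton p w (p ^ (n + k)) := by
  refine (hasSum_zpow_mul_hahnExton_self hp0 hp1 hw0 hw1 k).summable.norm.of_norm_bounded
    fun n => ?_
  have h1 := zpow_pos hw0 n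
  have h2 := zpow_pos hp0 n
  rw [norm_mul, norm_mul, norm_div, Real.norm_of_nonneg h1.le,
    Real.norm_of_nonneg (show 0 ≤ 1 + p ^ n by positivity)]
  exact mul_le_mul_of_nonneg_right (div_le_self h1.le (by linarith)) (norm_nonneg _)

theorem modifiedBesselEq_besselISeq {p : ℝ} (hp0 : 0 < p) (hp1 : p < 1) (b : ℝ) :
    ModifiedBesselEq p b (besselISeq p b) := fun k => by
  have h := hahnExton_recurrence hp0 hp1 (b * p) (-p ^ (k + 1))
  have e1 : p * -p ^ (k + 1) = -p ^ (k + 1 + 1) := by rw [zpow_add_one₀ hp0.ne' (k + 1)]; ring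
  have e2 : p * -p ^ (k + 1 + 1) = -p ^ (k + 2 + 1) := by
    rw [show k + 2 + 1 = k + 1 + 1 + 1 by ring, zpow_add_one₀ hp0.ne' (k + 1 + 1)]; ring
  rw [e1, e2, mul_div_cancel_right₀ _ hp0.ne'] at h
  simp only [besselISeq]
  linear_combination h / qPochInf (b * p) p

theorem modifiedBesselEq_besselPiSeq {p b : ℝ} (hp0 : 0 < p) (hp1 : p < 1) (hb : b ≠ 0) :
    ModifiedBesselEq p b (besselPiSeq p b) := fun k => by
  have h := hahnExton_recurrence hp0 hp1 (p / b) (-(p ^ (k + 1) / b))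
  have e1 : p * -(p ^ (k + 1) / b) = -(p ^ (k + 1 + 1) / b) := by
    rw [zpow_add_one₀ hp0.ne' (k + 1)]; ring
  have e2 : p * -(p ^ (k + 1 + 1) / b) = -(p ^ (k + 2 + 1) / b) := by
    rw [show k + 2 + 1 = k + 1 + 1 + 1 by ring, zpow_add_one₀ hp0.ne' (k + 1 + 1)]; ring
  have e3 : p / b / p = b⁻¹ := by field_simp
  rw [e1, e2, e3] at h
  simp only [besselPiSeq]
  have e4 : (b ^ (k + 1))⁻¹ = (b ^ k)⁻¹ * b⁻¹ := by rw [zpow_add_one₀ hb, mul_inv]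
  have e5 : (b ^ (k + 2))⁻¹ = (b ^ k)⁻¹ * b⁻¹ * b⁻¹ := by
    rw [show k + 2 = k + 1 + 1 by ring, zpow_add_one₀ hb, zpow_add_one₀ hb, mul_inv, mul_inv]
  have e6 : b * b⁻¹ = 1 := mul_inv_cancel₀ hb
  rw [e4, e5]
  linear_combination (b ^ k)⁻¹ / qPochInf (p / b) p * (h +
    (-hahnExton p (p / b) (-(p ^ (k + 1 + 1) / b)) + b⁻¹ *
      hahnExton p (p / b) (-(p ^ (k + 2 + 1) / b))) * e6)

theorem modifiedBesselEq_macdonaldSeq {p b : ℝ} (hp0 : 0 < p) (hp1 : p < 1) (hb : 0 < b)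
    (hb1 : b * p < 1) : ModifiedBesselEq p b (macdonaldSeq p (b * p)) := fun k => by
  have hw0 : 0 < b * p := mul_pos hb hp0
  have hs : ∀ k : ℤ, HasSum _ (macdonaldSeq p (b * p) k) := fun k => by
    have := (summable_macdonaldSeq hp0 hp1 hw0 hb1 (k + 1)).hasSum
    simp only [← add_assoc] at this
    exact this
  have h1 := (((hs k).sub ((hs (k + 1)).mul_left (1 + b))).add ((hs (k + 2)).mul_left b)).sub
    ((hs (k + 1)).mul_left (p ^ (k + 1)))
  have h2 := (hasSum_zpow_mul_hahnExton_self hp0 hp1 hw0 hb1 (k + 2)).mul_left (-p ^ (k + 1))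
  rw [mul_zero] at h2
  -- With `z = p^(n+k+1)`, the terms `-z` and `-p^(k+1)` add up to `-p^(k+1) (1 + p^n)`, which
  -- cancels the denominator and leaves the vanishing Mellin sum.
  refine sub_eq_zero.1 (h1.unique (h2.congr_fun fun n => ?_))
  have h := hahnExton_recurrence hp0 hp1 (b * p) (p ^ (n + k + 1))
  have e0 : p ^ (n + k + 1) = p ^ n * p ^ (k + 1) := by rw [add_assoc, zpow_add₀ hp0.ne']
  have e1 : p * p ^ (n + k + 1) = p ^ (n + (k + 2)) := by
    rw [show n + (k + 2) = n + k + 1 + 1 by ring, zpow_add_one₀ hp0.ne' (n + k + 1)]; ring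
  have e2 : p * p ^ (n + (k + 2)) = p ^ (n + (k + 2) + 1) := by
    rw [zpow_add_one₀ hp0.ne' (n + (k + 2))]; ring
  rw [e1, e2, mul_div_cancel_right₀ _ hp0.ne'] at h
  rw [show n + (k + 1) + 1 = n + (k + 2) by ring]
  generalize hahnExton p (b * p) (p ^ (n + k + 1)) = x0 at h ⊢
  generalize hahnExton p (b * p) (p ^ (n + (k + 2))) = x1 at h ⊢
  generalize hahnExton p (b * p) (p ^ (n + (k + 2) + 1)) = x2 at h ⊢
  rw [e0] at h
  have h3 : 1 + p ^ n ≠ 0 := by have := zpow_pos hp0 n; positivity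
  field_simp
  linear_combination h

/-! ### Behaviour at the ends of the lattice -/

theorem tendsto_zpow_atTop_nhds_zero {r : ℝ} (h0 : 0 < r) (h1 : r < 1) :
    Tendsto (fun k : ℤ => r ^ k) atTop (𝓝 0) := by
  rw [← Nat.map_cast_int_atTop, tendsto_map'_iff]
  simpa [Function.comp_def] using tendsto_pow_atTop_nhds_zero_of_lt_one h0.le h1

theorem hasSum_hahnExton_div_qPochInf {p w : ℝ} (hp0 : 0 < p) (hp1 : p < 1) (hw : ∀ i : ℕ, w * p ^ i ≠ 1)
    (z : ℝ) :
    HasSum (fun k => eulerCoeff p k / qPoch w p k * z ^ k) (hahnExton p w z / qPochInf w p) := by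
  refine ((summable_hahnExton hp0 hp1 w z).hasSum.div_const _).congr_fun fun k => ?_
  have h1 := qPoch_ne_zero hw k
  have h2 := qPochInf_ne_zero hp0 hp1 hw
  have h3 := qPochInf_eq_qPoch_mul hp0 hp1 w k
  have h4 : qPochInf (w * p ^ k) p = qPochInf w p / qPoch w p k := by
    rw [h3, mul_div_cancel_left₀ _ h1]
  rw [h4]
  field_simp

/-- At a negative argument the alternating signs cancel: every term is nonnegative and the first is
1. -/
theorem one_le_besselISeq {p b : ℝ} (hp0 : 0 < p) (hp1 : p < 1) (hb : 0 < b) (hb1 : b * p < 1)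
    (k : ℤ) : 1 ≤ besselISeq p b k := by
  have hw : ∀ i : ℕ, b * p * p ^ i ≠ 1 := fun i => ne_of_lt <|
    (mul_le_of_le_one_right (by positivity) (pow_le_one₀ hp0.le hp1.le)).trans_lt hb1
  have h := hasSum_hahnExton_div_qPochInf hp0 hp1 hw (-p ^ (k + 1))
  have h1 := h.summable.le_tsum 0 fun j _ => ?_
  · rw [h.tsum_eq] at h1
    simpa [eulerCoeff_zero, qPoch, besselISeq] using h1
  · have h2 := qPoch_pos hp0 hp1 hb1 j
    have h3 := qPoch_pos hp0 hp1 hp1 j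
    have h4 : eulerCoeff p j / qPoch (b * p) p j * (-p ^ (k + 1)) ^ j =
        p ^ (j.choose 2) / qPoch p p j / qPoch (b * p) p j * (p ^ (k + 1)) ^ j := by
      rw [eulerCoeff, neg_pow (p ^ (k + 1))]
      have : ((-1 : ℝ) ^ j) * (-1) ^ j = 1 := by rw [← mul_pow]; simp
      linear_combination (p ^ (j.choose 2) / qPoch p p j / qPoch (b * p) p j *
        (p ^ (k + 1)) ^ j) * this
    rw [h4]
    have := zpow_pos hp0 (k + 1)
    positivity

theorem one_le_qPoch_neg {p y : ℝ} (hp0 : 0 < p) (hy : 0 ≤ y) (j : ℕ) : 1 ≤ qPoch (-y) p j := by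
  induction j with
  | zero => simp [qPoch]
  | succ j ih =>
    rw [qPoch_succ]
    have := mul_nonneg hy (pow_pos hp0 j).le
    exact one_le_mul_of_one_le_of_one_le ih (by linarith)

theorem le_qPoch_neg {p y : ℝ} (hp0 : 0 < p) (hy : 0 ≤ y) (j : ℕ) : y ≤ qPoch (-y) p (j + 1) := by
  rw [qPoch_succ', neg_mul]
  have := one_le_qPoch_neg hp0 (mul_nonneg hy hp0.le) j
  nlinarith

/-- By symmetry, with `y = c p^k`, the quotient is a series in `w^j / (-y;p)_j`. As `y → ∞` every
term but the first vanishes, with domination from `(-y;p)_j ≥ 1`. -/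
theorem tendsto_hahnExton_div_atBot {p c : ℝ} (hp0 : 0 < p) (hp1 : p < 1) (hc : 0 < c) (w : ℝ) :
    Tendsto (fun k : ℤ => hahnExton p w (-(c * p ^ k)) / qPochInf (-(c * p ^ k)) p) atBot (𝓝 1) := by
  have hy : ∀ k : ℤ, 0 < c * p ^ k := fun k => mul_pos hc (zpow_pos hp0 k)
  have hne : ∀ (k : ℤ) (i : ℕ), -(c * p ^ k) * p ^ i ≠ 1 := fun k i => by
    have := mul_pos (hy k) (pow_pos hp0 i)
    linarith
  simp only [hahnExton_comm hp0 hp1 w]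
  simp only [← (hasSum_hahnExton_div_qPochInf hp0 hp1 (hne _) w).tsum_eq]
  have h0 : ∑' j : ℕ, (if j = 0 then (1 : ℝ) else 0) = 1 := tsum_ite_eq 0 _
  rw [← h0]
  refine tendsto_tsum_of_dominated_convergence (summable_eulerCoeff hp0 hp1 w).norm (fun j => ?_)
    (Eventually.of_forall fun k j => ?_)
  · cases j with
    | zero => simp [eulerCoeff_zero, qPoch]
    | succ j =>
      have hlim : Tendsto (fun k : ℤ => (c * p ^ k)⁻¹) atBot (𝓝 0) := by
        have h := ((tendsto_zpow_atTop_nhds_zero hp0 hp1).comp tendsto_neg_atBot_atTop).const_mul c⁻¹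
        simpa [Function.comp_def, mul_comm] using h
      have h1 : Tendsto (fun k : ℤ => (qPoch (-(c * p ^ k)) p (j + 1))⁻¹) atBot (𝓝 0) := by
        refine squeeze_zero (fun k => ?_) (fun k => ?_) hlim
        · exact inv_nonneg.2 (zero_le_one.trans (one_le_qPoch_neg hp0 (hy k).le _))
        · exact inv_anti₀ (hy k) (le_qPoch_neg hp0 (hy k).le j)
      have h2 := (h1.const_mul (eulerCoeff p (j + 1))).mul_const (w ^ (j + 1))
      simpa [div_eq_mul_inv] using h2
  · have h1 := one_le_qPoch_neg hp0 (hy k).le j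
    rw [div_mul_eq_mul_div, norm_div]
    exact div_le_self (norm_nonneg _) (h1.trans (le_abs_self _))

/-- Theta-type quasi-periodicity: the first `N` factors `1 + p^(-j)/a` equal `(1 + a p^j)/(a p^j)`.
-/
theorem qPochInf_neg_zpow {p a : ℝ} (hp0 : 0 < p) (hp1 : p < 1) (ha : 0 < a) (N : ℕ) :
    qPochInf (-(p ^ (-(N : ℤ) + 1) / a)) p * a ^ N * p ^ (N.choose 2) =
      qPochInf (-(p / a)) p * qPoch (-a) p N := by
  induction N with
  | zero => simp [qPoch]
  | succ N ih =>
    have e1 : p ^ (-((N + 1 : ℕ) : ℤ) + 1) = (p ^ N)⁻¹ := by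
      rw [← zpow_natCast, ← zpow_neg]; congr 1; push_cast; ring
    have e2 : p ^ (-(N : ℤ) + 1) = (p ^ N)⁻¹ * p := by
      rw [zpow_add_one₀ hp0.ne', zpow_neg, zpow_natCast]
    have e3 : -((p ^ N)⁻¹ / a) * p = -((p ^ N)⁻¹ * p / a) := by ring
    have e4 : (N + 1).choose 2 = N + N.choose 2 := by simp [Nat.choose_succ_succ']
    rw [e2] at ih
    rw [e1, qPochInf_eq_mul hp0 hp1, e3, qPoch_succ, ← mul_assoc, ← ih, e4, pow_add, pow_succ]
    have := pow_pos hp0 N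
    field_simp
    ring

/-- The constant `β_ν` in terms of `b = p^ν`. -/
noncomputable def betaConst (p b : ℝ) : ℝ :=
  qPochInf (b * p) p / qPochInf (p / b) p *
    (qPochInf (-b) p * qPochInf (-(p / b)) p / (qPochInf (-1) p * qPochInf (-p) p))

theorem tendsto_besselPiSeq_div_besselISeq {p b : ℝ} (hp0 : 0 < p) (hp1 : p < 1) (hb : 0 < b) :
    Tendsto (fun k => besselPiSeq p b k / besselISeq p b k) atBot (𝓝 (betaConst p b)) := by
  have hneg : ∀ {a : ℝ}, 0 < a → qPochInf (-a) p ≠ 0 := fun h =>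
    qPochInf_ne_zero_of_lt_one hp0 hp1 (by linarith)
  have h1 : Tendsto (fun k : ℤ => (b ^ k)⁻¹ * qPochInf (-(p ^ (k + 1) / b)) p /
      qPochInf (-p ^ (k + 1)) p) atBot
      (𝓝 (qPochInf (-b) p * qPochInf (-(p / b)) p / (qPochInf (-1) p * qPochInf (-p) p))) := by
    have hN : Tendsto (fun N : ℕ => (qPochInf (-(p / b)) p * qPoch (-b) p N) /
        (qPochInf (-p) p * qPoch (-1) p N)) atTop
        (𝓝 (qPochInf (-b) p * qPochInf (-(p / b)) p / (qPochInf (-1) p * qPochInf (-p) p))) := by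
      rw [mul_comm (qPochInf (-b) p), mul_comm (qPochInf (-1) p)]
      exact ((tendsto_qPoch hp0 hp1 (-b)).const_mul _).div
        ((tendsto_qPoch hp0 hp1 (-1)).const_mul _)
        (mul_ne_zero (hneg hp0) (hneg one_pos))
    have hbot : (atBot : Filter ℤ) = map (fun N : ℕ => -(N : ℤ)) atTop := by
      have : (fun N : ℕ => -(N : ℤ)) = Neg.neg ∘ ((↑) : ℕ → ℤ) := rfl
      rw [this, ← Filter.map_map, Nat.map_cast_int_atTop, Filter.map_neg_atTop]
    rw [hbot, tendsto_map'_iff]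
    refine hN.congr fun N => ?_
    have e1 := qPochInf_neg_zpow hp0 hp1 hb N
    have e2 := qPochInf_neg_zpow hp0 hp1 one_pos N
    simp only [div_one, one_pow, mul_one] at e2
    have h2 := (pow_pos hp0 (N.choose 2)).ne'
    -- The powers of `p` agree for `a = b` and `a = 1`; the remaining `b^N` is the prefactor
    -- `(b^k)⁻¹` at `k = -N`.
    rw [← e1, ← e2, mul_div_mul_right _ _ h2]
    simp only [Function.comp_apply]
    rw [zpow_neg, inv_inv, zpow_natCast, mul_comm (b ^ N)]
  have h2 := tendsto_hahnExton_div_atBot hp0 hp1 (div_pos hp0 hb) (p / b)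
  have h3 := tendsto_hahnExton_div_atBot hp0 hp1 hp0 (b * p)
  have h4 := ((h1.mul h2).div h3 one_ne_zero).const_mul (qPochInf (b * p) p / qPochInf (p / b) p)
  rw [mul_one, div_one] at h4
  refine h4.congr fun k => ?_
  have e1 : p / b * p ^ k = p ^ (k + 1) / b := by rw [zpow_add_one₀ hp0.ne']; ring
  have e2 : p * p ^ k = p ^ (k + 1) := by rw [zpow_add_one₀ hp0.ne']; ring
  have h5 := hneg (zpow_pos hp0 (k + 1))
  have h6 := hneg (div_pos (zpow_pos hp0 (k + 1)) hb)
  simp only [Pi.div_apply, e1, e2, besselPiSeq, besselISeq]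
  field_simp

theorem tendsto_macdonaldSeq_atBot {p w : ℝ} (hp0 : 0 < p) (hp1 : p < 1) (hw0 : 0 < w)
    (hw1 : w < 1) : Tendsto (macdonaldSeq p w) atBot (𝓝 0) := by
  have h := (hasSum_zpow_mul_hahnExton hp0 hp1 hw0 hw1 w).summable.norm
  have hlim : Tendsto (fun k : ℤ => w ^ (-(k + 1)) * ∑' m : ℤ, ‖w ^ m * hahnExton p w (p ^ m)‖)
      atBot (𝓝 0) := by
    have h1 : Tendsto (fun k : ℤ => -(k + 1)) atBot atTop :=
      tendsto_neg_atBot_atTop.comp (tendsto_atBot_add_const_right _ 1 tendsto_id)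
    simpa using ((tendsto_zpow_atTop_nhds_zero hw0 hw1).comp h1).mul_const _
  refine squeeze_zero_norm (fun k => ?_) hlim
  have h2 := ((Equiv.addRight (k + 1)).hasSum_iff.2 h.hasSum).mul_left (w ^ (-(k + 1)))
  refine tsum_of_norm_bounded h2 fun n => ?_
  simp only [Function.comp_apply, Equiv.coe_addRight]
  have h3 := zpow_pos hp0 n
  have h4 := zpow_pos hw0 n
  have h5 := zpow_pos hw0 (-(k + 1))
  rw [norm_mul, norm_mul, zpow_add₀ hw0.ne' n, norm_mul, norm_div, Real.norm_of_nonneg h4.le,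
    Real.norm_of_nonneg (zpow_pos hw0 (k + 1)).le,
    Real.norm_of_nonneg (show 0 ≤ 1 + p ^ n by positivity), ← mul_assoc, mul_left_comm _ (w ^ n),
    ← zpow_add₀ hw0.ne', neg_add_cancel, zpow_zero, mul_one, add_assoc]
  exact mul_le_mul_of_nonneg_right (div_le_self h4.le (by linarith)) (norm_nonneg _)

theorem tendsto_besselISeq_atTop {p b : ℝ} (hp0 : 0 < p) (hp1 : p < 1) (hb1 : b * p < 1) :
    Tendsto (besselISeq p b) atTop (𝓝 1) := by
  have h1 := qPochInf_ne_zero_of_lt_one hp0 hp1 hb1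
  have h2 : Tendsto (fun k : ℤ => -p ^ (k + 1)) atTop (𝓝 0) := by
    simpa using ((tendsto_zpow_atTop_nhds_zero hp0 hp1).comp
      (tendsto_atTop_add_const_right _ 1 tendsto_id)).neg
  have h3 := (tendsto_hahnExton_zero hp0 hp1 (b * p) h2).div_const (qPochInf (b * p) p)
  rwa [div_self h1] at h3

theorem tendsto_zpow_mul_besselPiSeq_atTop {p b : ℝ} (hp0 : 0 < p) (hp1 : p < 1) (hb : 0 < b)
    (h1 : qPochInf (p / b) p ≠ 0) :
    Tendsto (fun k : ℤ => b ^ k * besselPiSeq p b k) atTop (𝓝 1) := by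
  have h2 : Tendsto (fun k : ℤ => -(p ^ (k + 1) / b)) atTop (𝓝 0) := by
    simpa using (((tendsto_zpow_atTop_nhds_zero hp0 hp1).comp
      (tendsto_atTop_add_const_right _ 1 tendsto_id)).div_const b).neg
  have h3 := (tendsto_hahnExton_zero hp0 hp1 (p / b) h2).div_const (qPochInf (p / b) p)
  rw [div_self h1] at h3
  refine h3.congr fun k => ?_
  rw [besselPiSeq, mul_inv_cancel_left₀ (zpow_pos hb k).ne']

theorem summable_zpow_div_one_add {p w : ℝ} (hp0 : 0 < p) (hw1 : w < 1) (hpw : p < w) :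
    Summable fun n : ℤ => w ^ n / (1 + p ^ n) := by
  have hw0 := hp0.trans hpw
  refine Summable.of_nat_of_neg ?_ ?_
  · refine (summable_geometric_of_lt_one hw0.le hw1).of_nonneg_of_le (fun n => ?_) fun n => ?_
    · rw [zpow_natCast, zpow_natCast]; positivity
    · rw [zpow_natCast, zpow_natCast]
      exact div_le_self (by positivity) (by linarith [pow_pos hp0 n])
  · refine (summable_geometric_of_lt_one (div_pos hp0 hw0).le
      ((div_lt_one hw0).2 hpw)).of_nonneg_of_le (fun n => ?_) fun n => ?_
    · have h1 := zpow_pos hp0 (-(n : ℤ))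
      have h2 := zpow_pos hw0 (-(n : ℤ))
      positivity
    · rw [zpow_neg, zpow_neg, zpow_natCast, zpow_natCast, div_pow]
      have h1 := pow_pos hp0 n
      have h2 := pow_pos hw0 n
      rw [div_le_div_iff₀ (by positivity) h2, inv_mul_cancel₀ h2.ne', mul_add,
        mul_inv_cancel₀ h1.ne']
      linarith

/-- For `p < w`, that is `ν < 0`, the weight is summable by itself, so the limit passes inside the
sum. -/
theorem tendsto_macdonaldSeq_atTop {p w : ℝ} (hp0 : 0 < p) (hp1 : p < 1) (hw1 : w < 1)
    (hpw : p < w) : Tendsto (macdonaldSeq p w) atTop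
      (𝓝 ((∑' n : ℤ, w ^ n / (1 + p ^ n)) * qPochInf w p)) := by
  obtain ⟨C, hC⟩ := exists_abs_hahnExton_zpow_le (w := w) hp0 hp1
  rw [← tsum_mul_right]
  refine tendsto_tsum_of_dominated_convergence
    ((summable_zpow_div_one_add hp0 hw1 hpw).norm.mul_right C) (fun n => ?_)
    (Eventually.of_forall fun k n => ?_)
  · refine (tendsto_hahnExton_zero hp0 hp1 w ?_).const_mul _
    refine (tendsto_zpow_atTop_nhds_zero hp0 hp1).comp (tendsto_atTop_add_const_right _ 1 ?_)
    exact tendsto_atTop_add_const_left _ n tendsto_id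
  · rw [norm_mul]
    exact mul_le_mul_of_nonneg_left (hC _) (norm_nonneg _)

/-- In the variable `m = n + k + 1` the weight becomes `b^(m-1) / (1 + p^(k+1-m))`. Its denominator
tends to 1, leaving the Mellin sum at `u = b`, where `w/u = p`. -/
theorem tendsto_zpow_mul_macdonaldSeq_atTop {p b : ℝ} (hp0 : 0 < p) (hp1 : p < 1) (hb : 0 < b)
    (hb1 : b < 1) : Tendsto (fun k : ℤ => b ^ k * macdonaldSeq p (b * p) k) atTop
      (𝓝 (qPochInf p p ^ 2 / qPochInf b p)) := by
  have hM := (hasSum_zpow_mul_hahnExton hp0 hp1 hb hb1 (b * p)).mul_left b⁻¹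
  have e : b⁻¹ * (b * qPochInf p p / qPochInf b p * qPochInf (b * p / b) p) =
      qPochInf p p ^ 2 / qPochInf b p := by
    rw [mul_div_cancel_left₀ _ hb.ne']; field_simp
  rw [e] at hM
  rw [← hM.tsum_eq]
  have hk : ∀ k : ℤ, b ^ k * macdonaldSeq p (b * p) k =
      ∑' m : ℤ, (1 + p ^ (k + 1 - m))⁻¹ * (b⁻¹ * (b ^ m * hahnExton p (b * p) (p ^ m))) := by
    intro k
    rw [macdonaldSeq, ← tsum_mul_left]
    refine Eq.trans ?_ ((Equiv.addRight (k + 1)).tsum_eq _)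
    refine tsum_congr fun n => ?_
    simp only [Equiv.coe_addRight]
    have h1 := zpow_pos hp0 n
    have h3 := zpow_pos hb n
    have h4 := zpow_pos hb k
    rw [← add_assoc, show k + 1 - (n + k + 1) = -n by ring, zpow_neg, mul_zpow,
      zpow_add_one₀ hb.ne', zpow_add₀ hb.ne']
    field_simp
    ring
  simp only [hk]
  refine tendsto_tsum_of_dominated_convergence hM.summable.norm (fun m => ?_)
    (Eventually.of_forall fun k m => ?_)
  · have h1 : Tendsto (fun k : ℤ => p ^ (k + 1 - m)) atTop (𝓝 0) := by
      refine ((tendsto_zpow_atTop_nhds_zero hp0 hp1).comp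
        (tendsto_atTop_add_const_right _ (1 - m) tendsto_id)).congr fun k => ?_
      simp [add_sub_assoc]
    simpa using ((h1.const_add 1).inv₀ (by simp)).mul_const
      (b⁻¹ * (b ^ m * hahnExton p (b * p) (p ^ m)))
  · have h1 := zpow_pos hp0 (k + 1 - m)
    rw [norm_mul]
    refine mul_le_of_le_one_left (norm_nonneg _) ?_
    rw [Real.norm_of_nonneg (by positivity)]
    exact inv_le_one_of_one_le₀ (by linarith)

/-! ### The connection formula -/

theorem betaConst_ne_zero {p b : ℝ} (hp0 : 0 < p) (hp1 : p < 1) (hb : 0 < b) (hb1 : b * p < 1)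
    (h : qPochInf (p / b) p ≠ 0) : betaConst p b ≠ 0 := by
  have hneg : ∀ {a : ℝ}, 0 < a → qPochInf (-a) p ≠ 0 := fun h =>
    qPochInf_ne_zero_of_lt_one hp0 hp1 (by linarith)
  exact mul_ne_zero (div_ne_zero (qPochInf_ne_zero_of_lt_one hp0 hp1 hb1) h)
    (div_ne_zero (mul_ne_zero (hneg hb) (hneg (div_pos hp0 hb)))
      (mul_ne_zero (hneg one_pos) (hneg hp0)))

/-- If `π = cI`, comparing behaviour at `+∞` gives `b^k c → 1`; shifting `k` by one forces `b = 1`.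
-/
theorem casoratian_besselPiSeq_ne_zero {p b : ℝ} (hp0 : 0 < p) (hp1 : p < 1) (hb : 0 < b)
    (hb1 : b * p < 1) (hbne : b ≠ 1) (h : qPochInf (p / b) p ≠ 0) :
    casoratian (besselPiSeq p b) (besselISeq p b) 0 ≠ 0 := fun h0 => by
  have hI := modifiedBesselEq_besselISeq hp0 hp1 b
  have hpi := modifiedBesselEq_besselPiSeq hp0 hp1 hb.ne'
  have hI0 : ∀ k, besselISeq p b k ≠ 0 := fun k =>
    (zero_lt_one.trans_le (one_le_besselISeq hp0 hp1 hb hb1 k)).ne'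
  obtain ⟨c, hc⟩ := exists_eq_mul_of_casoratian_eq_zero hI0
    (hpi.casoratian_eq_zero hb.ne' hI h0)
  have h1 := (tendsto_zpow_mul_besselPiSeq_atTop hp0 hp1 hb h).div
    (tendsto_besselISeq_atTop hp0 hp1 hb1) one_ne_zero
  rw [div_one] at h1
  have h2 : Tendsto (fun k : ℤ => b ^ k * c) atTop (𝓝 1) := by
    refine h1.congr fun k => ?_
    rw [Pi.div_apply, hc, ← mul_assoc, mul_div_cancel_right₀ _ (hI0 k)]
  have h3 := h2.comp (tendsto_atTop_add_const_right _ (1 : ℤ) tendsto_id)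
  have h4 : Tendsto (fun k : ℤ => b * (b ^ k * c)) atTop (𝓝 1) := by
    refine h3.congr fun k => ?_
    simp only [Function.comp_apply, id, zpow_add_one₀ hb.ne']
    ring
  exact hbne (by simpa using tendsto_nhds_unique (h2.const_mul b) h4)

theorem macdonaldSeq_eq {p b : ℝ} (hp0 : 0 < p) (hp1 : p < 1) (hb : 0 < b) (hb1 : b * p < 1)
    (hbne : b ≠ 1) (h : qPochInf (p / b) p ≠ 0) (k : ℤ) :
    macdonaldSeq p (b * p) k =
      (if b < 1 then qPochInf p p ^ 2 / qPochInf b p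
        else -((∑' n : ℤ, (b * p) ^ n / (1 + p ^ n)) * qPochInf (b * p) p) / betaConst p b) *
      (besselPiSeq p b k - betaConst p b * besselISeq p b k) := by
  have hw0 : 0 < b * p := mul_pos hb hp0
  have hI := modifiedBesselEq_besselISeq hp0 hp1 b
  have hpi := modifiedBesselEq_besselPiSeq hp0 hp1 hb.ne'
  have hf := modifiedBesselEq_macdonaldSeq hp0 hp1 hb hb1
  have hI1 := one_le_besselISeq hp0 hp1 hb hb1
  have hI0 : ∀ k, besselISeq p b k ≠ 0 := fun k => (zero_lt_one.trans_le (hI1 k)).ne'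
  have hβ := betaConst_ne_zero hp0 hp1 hb hb1 h
  have hg := hpi.sub_mul hI 1 (betaConst p b)
  simp only [one_mul] at hg
  have hfI : Tendsto (fun k => macdonaldSeq p (b * p) k / besselISeq p b k) atBot (𝓝 0) := by
    refine squeeze_zero_norm (fun k => ?_) (by
      simpa using (tendsto_macdonaldSeq_atBot hp0 hp1 hw0 hb1).norm)
    rw [norm_div]
    exact div_le_self (norm_nonneg _) ((hI1 k).trans (le_abs_self _))
  have hgI : Tendsto (fun k => (besselPiSeq p b k - betaConst p b * besselISeq p b k) /
      besselISeq p b k) atBot (𝓝 0) := by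
    have h1 := (tendsto_besselPiSeq_div_besselISeq hp0 hp1 hb).sub_const (betaConst p b)
    rw [sub_self] at h1
    refine h1.congr fun k => ?_
    rw [sub_div, mul_div_cancel_right₀ _ (hI0 k)]
  -- Subtracting a multiple of `I` from `π` does not change the Casoratian with `I`.
  obtain ⟨c, hc⟩ := hf.exists_eq_mul hb.ne' hg hI hI0 hfI hgI (by
    have h1 := casoratian_besselPiSeq_ne_zero hp0 hp1 hb hb1 hbne h
    convert h1 using 1
    simp only [casoratian]
    ring)
  have hIlim := tendsto_besselISeq_atTop hp0 hp1 hb1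
  have hpilim := tendsto_zpow_mul_besselPiSeq_atTop hp0 hp1 hb h
  rw [hc k]
  congr 1
  split_ifs with hlt
  · have h1 := tendsto_zpow_mul_macdonaldSeq_atTop hp0 hp1 hb hlt
    have h2 := (hpilim.sub (((tendsto_zpow_atTop_nhds_zero hb hlt).mul hIlim).const_mul
      (betaConst p b))).const_mul c
    rw [zero_mul, mul_zero, sub_zero, mul_one] at h2
    refine tendsto_nhds_unique (h2.congr fun k => ?_) h1
    rw [hc k]
    ring
  · have hb1' : 1 < b := lt_of_le_of_ne (not_lt.1 hlt) hbne.symm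
    have h1 := tendsto_macdonaldSeq_atTop hp0 hp1 hb1 (lt_mul_of_one_lt_left hp0 hb1')
    have h2 := (((tendsto_zpow_atTop_nhds_zero (inv_pos.2 hb) (inv_lt_one_of_one_lt₀ hb1')).mul
      hpilim).sub (hIlim.const_mul (betaConst p b))).const_mul c
    rw [zero_mul, mul_one, zero_sub] at h2
    have h3 := tendsto_nhds_unique (h2.congr fun k => ?_) h1
    · rw [eq_div_iff hβ]
      linarith
    · rw [hc k, inv_zpow, inv_mul_cancel_left₀ (zpow_pos hb k).ne']

/-! ### Translation to the functions of the statement -/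

/-- Only `z²` enters, so imaginary arguments give real values. Since `n(n+1)/2 = n(n-1)/2 + n`, the
argument acquires a factor `p`, the source of the exponents `k + 1` in the lattice functions. -/
theorem qBesselJ_eq_ofReal {p μ s : ℝ} {z : ℂ} (hp0 : 0 < p) (hp1 : p < 1)
    (ha : ∀ i : ℕ, p ^ (μ + 1) * p ^ i ≠ 1) (hz : z ^ 2 = (s : ℂ)) :
    qBesselJ μ z p = ((hahnExton p (p ^ (μ + 1)) (p * s) / qPochInf (p ^ (μ + 1)) p : ℝ) : ℂ) := by
  rw [← (hasSum_hahnExton_div_qPochInf hp0 hp1 ha (p * s)).tsum_eq, Complex.ofReal_tsum]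
  refine tsum_congr fun n => ?_
  have h1 : n * (n + 1) / 2 = n.choose 2 + n := by
    have := Nat.choose_two_right (n + 1)
    rw [Nat.add_sub_cancel, mul_comm] at this
    rw [← this]
    simp [Nat.choose_succ_succ', add_comm]
  rw [qBesselTerm, pow_mul, hz, h1, eulerCoeff]
  push_cast
  rw [mul_pow, pow_add]
  ring

theorem rpow_mul_pow_ne_one {p μ : ℝ} (hp0 : 0 < p) (hp1 : p < 1) {i : ℕ} (h : μ + i ≠ 0) :
    p ^ μ * p ^ i ≠ 1 := by
  rw [← Real.rpow_natCast, ← Real.rpow_add hp0]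
  intro h1
  rcases lt_or_gt_of_ne h with h2 | h2
  · exact (Real.one_lt_rpow_of_pos_of_lt_one_of_neg hp0 hp1 h2).ne' h1
  · exact (Real.rpow_lt_one hp0.le hp1 h2).ne h1

theorem sq_rpow_eq {q : ℝ} (hq0 : 0 < q) (a : ℝ) : q ^ (2 * a) = (q ^ 2) ^ a := by
  rw [Real.rpow_mul hq0.le, Real.rpow_two]

theorem zpow_rpow_comm {q : ℝ} (hq0 : 0 < q) (k : ℤ) (a : ℝ) : (q ^ k) ^ a = (q ^ a) ^ k := by
  rw [← Real.rpow_intCast, ← Real.rpow_intCast, ← Real.rpow_mul hq0.le, ← Real.rpow_mul hq0.le,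
    mul_comm]

theorem zpow_sq_comm (q : ℝ) (k : ℤ) : (q ^ k) ^ 2 = (q ^ 2) ^ k := by
  rw [← zpow_natCast, ← zpow_natCast, zpow_comm]

theorem qMacdonaldBeta_eq {q : ℝ} (hq0 : 0 < q) (ν : ℝ) :
    qMacdonaldBeta ν q = betaConst (q ^ 2) ((q ^ 2) ^ ν) := by
  have hp0 : 0 < q ^ 2 := pow_pos hq0 2
  rw [qMacdonaldBeta, betaConst, show 2 * ν + 2 = 2 * (ν + 1) by ring,
    show -2 * ν + 2 = 2 * (1 - ν) by ring, show 2 - 2 * ν = 2 * (1 - ν) by ring, sq_rpow_eq hq0,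
    sq_rpow_eq hq0, sq_rpow_eq hq0, Real.rpow_add_one hp0.ne', Real.rpow_sub hp0, Real.rpow_one]

theorem qBesselI_zpow {q ν : ℝ} (hq0 : 0 < q) (hq1 : q < 1) (hν : -1 < ν) (k : ℤ) :
    qBesselI ν q (q ^ k) = (besselISeq (q ^ 2) ((q ^ 2) ^ ν) k : ℝ) := by
  have hp0 : 0 < q ^ 2 := pow_pos hq0 2
  have hp1 : q ^ 2 < 1 := pow_lt_one₀ hq0.le hq1 two_ne_zero
  have hz : (Complex.I * ((q ^ k : ℝ) : ℂ)) ^ 2 = ((-(q ^ 2) ^ k : ℝ) : ℂ) := by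
    rw [mul_pow, Complex.I_sq, ← zpow_sq_comm]
    push_cast
    ring
  have ha : ∀ i : ℕ, (q ^ 2) ^ (ν + 1) * (q ^ 2) ^ i ≠ 1 := fun i =>
    rpow_mul_pow_ne_one hp0 hp1 (by have : (0 : ℝ) ≤ i := i.cast_nonneg; linarith)
  rw [qBesselI, qBesselJ_eq_ofReal hp0 hp1 ha hz, besselISeq, Real.rpow_add_one hp0.ne',
    zpow_add_one₀ hp0.ne', mul_neg, mul_comm ((q ^ 2) ^ k)]

theorem qBesselPi_zpow {q ν : ℝ} (hq0 : 0 < q) (hq1 : q < 1)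
    (ha : ∀ i : ℕ, (q ^ 2) ^ (-ν + 1) * (q ^ 2) ^ i ≠ 1) (k : ℤ) :
    qBesselPi ν q (q ^ k) = (besselPiSeq (q ^ 2) ((q ^ 2) ^ ν) k : ℝ) := by
  have hp0 : 0 < q ^ 2 := pow_pos hq0 2
  have hp1 : q ^ 2 < 1 := pow_lt_one₀ hq0.le hq1 two_ne_zero
  have hz : (((q ^ (-ν) : ℝ) : ℂ) * Complex.I * ((q ^ k : ℝ) : ℂ)) ^ 2 =
      ((-((q ^ 2) ^ k / (q ^ 2) ^ ν) : ℝ) : ℂ) := by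
    have h1 : (q ^ (-ν)) ^ 2 = ((q ^ 2) ^ ν)⁻¹ := by
      rw [← Real.rpow_natCast, ← Real.rpow_mul hq0.le, ← Real.rpow_neg hp0.le, ← sq_rpow_eq hq0]
      congr 1
      push_cast
      ring
    rw [mul_pow, mul_pow, Complex.I_sq, ← zpow_sq_comm, div_eq_mul_inv, ← h1]
    push_cast
    ring
  have e1 : (q ^ 2) ^ (-ν + 1) = q ^ 2 / (q ^ 2) ^ ν := by
    rw [neg_add_eq_sub, Real.rpow_sub hp0, Real.rpow_one]
  rw [qBesselPi, qBesselJ_eq_ofReal hp0 hp1 ha hz, besselPiSeq, e1, ← Complex.ofReal_mul,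
    zpow_rpow_comm hq0, show -2 * ν = -(2 * ν) by ring, Real.rpow_neg hq0.le, sq_rpow_eq hq0,
    inv_zpow, zpow_add_one₀ hp0.ne']
  congr 5
  ring

theorem zpow_mul_zpow_rpow {q : ℝ} (hq0 : 0 < q) (ν : ℝ) (n : ℤ) :
    q ^ n * (q ^ n) ^ (2 * ν + 1) = ((q ^ 2) ^ ν * q ^ 2) ^ n := by
  have hp0 : 0 < q ^ 2 := pow_pos hq0 2
  rw [mul_comm, ← Real.rpow_add_one (zpow_pos hq0 n).ne',
    show 2 * ν + 1 + 1 = 2 * (ν + 1) by ring, zpow_rpow_comm hq0, sq_rpow_eq hq0,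
    Real.rpow_add_one hp0.ne']

theorem zpow_smul_weight {q : ℝ} (hq0 : 0 < q) (ν : ℝ) (n : ℤ) :
    q ^ n • ((1 + (q ^ n) ^ 2)⁻¹ * (q ^ n) ^ (2 * ν + 1)) =
      ((q ^ 2) ^ ν * q ^ 2) ^ n / (1 + (q ^ 2) ^ n) := by
  rw [smul_eq_mul, mul_left_comm, zpow_mul_zpow_rpow hq0, zpow_sq_comm, mul_comm, div_eq_mul_inv]

theorem zpow_smul_qMacdonaldIntegrand {q ν : ℝ} (hq0 : 0 < q) (hq1 : q < 1) (hν : -1 < ν)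
    (k n : ℤ) :
    q ^ n • qMacdonaldIntegrand ν q (q ^ k) (q ^ n) =
      ((((q ^ 2) ^ ν * q ^ 2) ^ n / (1 + (q ^ 2) ^ n) *
        hahnExton (q ^ 2) ((q ^ 2) ^ ν * q ^ 2) ((q ^ 2) ^ (n + k + 1)) /
          qPochInf ((q ^ 2) ^ ν * q ^ 2) (q ^ 2) : ℝ) : ℂ) := by
  have hp0 : 0 < q ^ 2 := pow_pos hq0 2
  have hp1 : q ^ 2 < 1 := pow_lt_one₀ hq0.le hq1 two_ne_zero
  have hz : (((q ^ n : ℝ) : ℂ) * ((q ^ k : ℝ) : ℂ)) ^ 2 = (((q ^ 2) ^ (n + k) : ℝ) : ℂ) := by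
    rw [← Complex.ofReal_mul, ← zpow_add₀ hq0.ne', ← Complex.ofReal_pow, zpow_sq_comm]
  have ha : ∀ i : ℕ, (q ^ 2) ^ (ν + 1) * (q ^ 2) ^ i ≠ 1 := fun i =>
    rpow_mul_pow_ne_one hp0 hp1 (by have : (0 : ℝ) ≤ i := i.cast_nonneg; linarith)
  rw [qMacdonaldIntegrand, qBesselJ_eq_ofReal hp0 hp1 ha hz, ← Complex.ofReal_mul,
    ← Complex.ofReal_mul, Complex.real_smul, ← Complex.ofReal_mul, ← zpow_smul_weight hq0,
    Real.rpow_add_one hp0.ne', zpow_add_one₀ hp0.ne' (n + k), mul_comm (q ^ 2) ((q ^ 2) ^ (n + k)),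
    smul_eq_mul]
  congr 1
  ring

theorem mainTheorem7 (q ν : ℝ) (hq0 : 0 < q) (hq1 : q < 1) (hν : -1 < ν)
    (hν' : ∀ m : ℕ, ν ≠ (m : ℝ)) :
    (∀ x ∈ qLattice q,
      QIntegrable q (qMacdonaldIntegrand ν q x) ∧
      qMacdonald ν q x =
        (qMacdonaldAlpha ν q : ℂ) *
          (qBesselPi ν q x - (qMacdonaldBeta ν q : ℂ) * qBesselI ν q x)) ∧
    (ν < 0 → QIntegrable q (fun t : ℝ => (1 + t ^ 2)⁻¹ * t ^ (2 * ν + 1))) := by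
  have hp0 : 0 < q ^ 2 := pow_pos hq0 2
  have hp1 : q ^ 2 < 1 := pow_lt_one₀ hq0.le hq1 two_ne_zero
  have hb : 0 < (q ^ 2) ^ ν := Real.rpow_pos_of_pos hp0 ν
  have hb1 : (q ^ 2) ^ ν * q ^ 2 < 1 := by
    rw [← Real.rpow_add_one hp0.ne']
    exact Real.rpow_lt_one hp0.le hp1 (by linarith)
  have hν0 : ν ≠ 0 := by simpa using hν' 0
  have hlt : (q ^ 2) ^ ν < 1 ↔ 0 ≤ ν := by
    rw [Real.rpow_lt_one_iff_of_pos hp0]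
    constructor
    · rintro (h | h)
      · linarith
      · exact h.2.le
    · exact fun h => Or.inr ⟨hp1, lt_of_le_of_ne h hν0.symm⟩
  have hbne : (q ^ 2) ^ ν ≠ 1 := by
    simpa using rpow_mul_pow_ne_one (μ := ν) (i := 0) hp0 hp1 (by simpa using hν0)
  -- Excluding positive integers `ν` keeps the denominators of `j_{-ν}` and of `β_ν` nonzero;
  -- excluding `ν = 0` gave `b ≠ 1`.
  have ha : ∀ i : ℕ, (q ^ 2) ^ (-ν + 1) * (q ^ 2) ^ i ≠ 1 := fun i =>
    rpow_mul_pow_ne_one hp0 hp1 fun h => hν' (i + 1) (by push_cast; linarith)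
  have hpb : qPochInf (q ^ 2 / (q ^ 2) ^ ν) (q ^ 2) ≠ 0 := by
    have := qPochInf_ne_zero hp0 hp1 ha
    rwa [neg_add_eq_sub, Real.rpow_sub hp0, Real.rpow_one] at this
  have hw := qPochInf_ne_zero_of_lt_one hp0 hp1 hb1
  have hpp := qPochInf_ne_zero_of_lt_one hp0 hp1 hp1
  have hq : 1 - q ≠ 0 := (sub_pos.2 hq1).ne'
  have hc : qBesselC ν q * (1 - q) =
      qPochInf ((q ^ 2) ^ ν * q ^ 2) (q ^ 2) / qPochInf (q ^ 2) (q ^ 2) := by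
    rw [qBesselC, show 2 * ν + 2 = 2 * (ν + 1) by ring, sq_rpow_eq hq0, Real.rpow_add_one hp0.ne']
    field_simp
  refine ⟨?_, fun hneg => ?_⟩
  · rintro x ⟨k, rfl⟩
    constructor
    · simp only [QIntegrable, zpow_smul_qMacdonaldIntegrand hq0 hq1 hν]
      have h := summable_macdonaldSeq hp0 hp1 (mul_pos hb hp0) hb1 (k + 1)
      simp only [← add_assoc] at h
      exact Complex.ofRealCLM.summable (h.div_const _)
    · have hα : qMacdonaldAlpha ν q = (if (q ^ 2) ^ ν < 1 then
            qPochInf (q ^ 2) (q ^ 2) ^ 2 / qPochInf ((q ^ 2) ^ ν) (q ^ 2)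
          else -((∑' n : ℤ, ((q ^ 2) ^ ν * q ^ 2) ^ n / (1 + (q ^ 2) ^ n)) *
            qPochInf ((q ^ 2) ^ ν * q ^ 2) (q ^ 2)) / betaConst (q ^ 2) ((q ^ 2) ^ ν)) /
          qPochInf (q ^ 2) (q ^ 2) := by
        simp only [qMacdonaldAlpha, hlt]
        split_ifs with h
        · rw [sq_rpow_eq hq0]
          field_simp
        · rw [qIntegral, qMacdonaldBeta_eq hq0]
          simp only [zpow_smul_weight hq0]
          rw [smul_eq_mul]
          linear_combination -((∑' n : ℤ, ((q ^ 2) ^ ν * q ^ 2) ^ n / (1 + (q ^ 2) ^ n)) /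
            betaConst (q ^ 2) ((q ^ 2) ^ ν)) * hc
      have hK : qMacdonald ν q (q ^ k) =
          ((macdonaldSeq (q ^ 2) ((q ^ 2) ^ ν * q ^ 2) k / qPochInf (q ^ 2) (q ^ 2) : ℝ) : ℂ) := by
        rw [qMacdonald, qIntegral]
        simp only [zpow_smul_qMacdonaldIntegrand hq0 hq1 hν]
        rw [← Complex.ofReal_tsum, tsum_div_const, ← macdonaldSeq, Complex.real_smul, ← mul_assoc,
          ← Complex.ofReal_mul, ← Complex.ofReal_mul, hc]
        congr 1
        generalize qPochInf ((q ^ 2) ^ ν * q ^ 2) (q ^ 2) = w at hw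
        field_simp
      rw [hK, qBesselI_zpow hq0 hq1 hν, qBesselPi_zpow hq0 hq1 ha, qMacdonaldBeta_eq hq0, hα,
        macdonaldSeq_eq hp0 hp1 hb hb1 hbne hpb, ← Complex.ofReal_mul, ← Complex.ofReal_sub,
        ← Complex.ofReal_mul]
      congr 1
      ring
  · simp only [QIntegrable, zpow_smul_weight hq0]
    have h1 : 1 < (q ^ 2) ^ ν := Real.one_lt_rpow_of_pos_of_lt_one_of_neg hp0 hp1 hneg
    exact summable_zpow_div_one_add hp0 hb1 (lt_mul_of_one_lt_left hp0 h1)
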